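/- Let $X$ be an infinite-dimensional real Banach space that admits an equivalent norm which is URED. Then there exists an equivalent norm on $X$ which is URED and not WUR, and the class of all such equivalent norms is dense. If, moreover, $X$ admits an equivalent norm which is LUR, then there exists an equivalent norm on $X$ which is URED, LUR and not WUR, and the class of all such equivalent norms is dense. Here an equivalent norm $\|\cdot\|$ on $X$ is called (i) weakly uniformly rotund (WUR) if for all sequences $(x_n),(y_n)$ in $X$ with $\|x_n\|\le 1$, $\|y_n\|\le 1$ and $\left\|\frac{x_n+y_n}{2}\right\|\to 1$ one has $y_n-x_n\to 0$ in the weak topology of $X$; (ii) uniformly rotund in every direction (URED) if for every $v\in X$ with $\|v\|=1$ and all sequences $(x_n),(y_n)$ in $X$ and $(\lambda_n)$ in $\mathbb{R}$ with $\|x_n\|\le 1$, $\|y_n\|\le 1$, $y_n-x_n=\lambda_n v$ and $\left\|\frac{x_n+y_n}{2}\right\|\to 1$ one has $\lambda_n\to 0$; (iii) locally uniformly rotund (LUR) if for every $x\in X$ with $\|x\|=1$ and every sequence $(y_n)$ in $X$ with $\|y_n\|\le 1$ and $\left\|\frac{x+y_n}{2}\right\|\to 1$ one has $\|x-y_n\|\to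 0$. A class $\mathcal{S}$ of equivalent norms on $X$ is dense if for every equivalent norm $\|\cdot\|$ on $X$ and every $\varepsilon>0$ there is a norm $|\!|\!|\cdot|\!|\!|\in\mathcal{S}$ with $|\!|\!|x|\!|\!|\le\|x\|\le(1+\varepsilon)|\!|\!|x|\!|\!|$ for all $x\in X$. -/

import Mathlib

open Filter Topology

namespace Renorming

variable {X : Type*} [NormedAddCommGroup X] [NormedSpace ℝ X]

/-- A seminorm `p` on `X` is an equivalent norm: it is bounded below and above by positive multiples
of the given norm of `X` (in particular `p x = 0` only for `x = 0`). -/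
def IsEquivalentNorm (p : Seminorm ℝ X) : Prop :=
  ∃ a b : ℝ, 0 < a ∧ 0 < b ∧ ∀ x : X, a * ‖x‖ ≤ p x ∧ p x ≤ b * ‖x‖

/-- Weak uniform rotundity. The weak topology is that of `X`; it is the same for all
equivalent norms. -/
def IsWUR (p : Seminorm ℝ X) : Prop :=
  ∀ x y : ℕ → X, (∀ n, p (x n) ≤ 1) → (∀ n, p (y n) ≤ 1) →
    Tendsto (fun n => p ((2⁻¹ : ℝ) • (x n + y n))) atTop (𝓝 1) →
    Tendsto (fun n => toWeakSpace ℝ X (y n - x n)) atTop (𝓝 0)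

/-- Uniform rotundity in every direction. -/
def IsURED (p : Seminorm ℝ X) : Prop :=
  ∀ v : X, p v = 1 → ∀ (x y : ℕ → X) (c : ℕ → ℝ),
    (∀ n, p (x n) ≤ 1) → (∀ n, p (y n) ≤ 1) → (∀ n, y n - x n = c n • v) →
    Tendsto (fun n => p ((2⁻¹ : ℝ) • (x n + y n))) atTop (𝓝 1) →
    Tendsto c atTop (𝓝 0)

/-- Local uniform rotundity (at every point of the unit sphere). -/
def IsLUR (p : Seminorm ℝ X) : Prop :=
  ∀ x : X, p x = 1 → ∀ y : ℕ → X, (∀ n, p (y n) ≤ 1) →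
    Tendsto (fun n => p ((2⁻¹ : ℝ) • (x + y n))) atTop (𝓝 1) →
    Tendsto (fun n => p (x - y n)) atTop (𝓝 0)

/-- A class `S` of equivalent norms is dense if every equivalent norm `p` can be approximated
uniformly on bounded sets by members `q` of `S`. -/
def IsDenseClass (S : Set (Seminorm ℝ X)) : Prop :=
  ∀ p : Seminorm ℝ X, IsEquivalentNorm p → ∀ ε : ℝ, 0 < ε →
    ∃ q ∈ S, ∀ x : X, q x ≤ p x ∧ p x ≤ (1 + ε) * q x

end Renorming

open Filter Topology

namespace Renorming

variable {X : Type*} [NormedAddCommGroup X] [NormedSpace ℝ X]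

/-! Let `p` be the norm to approximate and `N` a URED norm. The new norm `q` is a supremum of norms
`G i`, each a quadratic mean of a seminorm close to `p`, or dominated by it up to a small factor,
and of small multiples of rotund terms. The squared norm of an `ℓ²`-sum has a midpoint convexity
defect that is the sum of the defects of its terms, so each `G i` inherits rotundity from any of its
terms.

WUR fails because of the cutting functionals `F n = B + ρ φ n`, whose peaks `pt n = b + r w n` stick
out of the rest of the ball by a fixed amount. Through each peak runs a segment of fixed length in
the direction `v n = e + w (n + 1)`. Along it `F n` and `N ∘ proj n` are constant, while the `ℓ²`
term `T` and the weight of `N` in `G (some n)` tend to zero. The sphere of `q` is thus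
asymptotically flat there, yet `f (v n) = 1`, so the `v n` are not weakly null (`not_isWUR_q`).

URED survives because the flat directions vary with `n`. A fixed direction `v` with `toL2 v ≠ 0` is
controlled by `T` uniformly in `n`; if `toL2 v = 0`, then every `proj n` fixes `v` and `N ∘ proj n`
controls it uniformly (`isURED_q`).

LUR of `N` passes to `q` because `base` dominates `1 + μ` times the upper limit of the `|F n|`: at a
given point of the sphere only finitely many `G (some n)` come close to `1`, and in those the weight
of `N` is bounded below (`isLUR_q`). For the second half of the theorem, `N` is the `ℓ²`-sum of a
URED norm and an LUR norm. -/

/-! ### Quadratic sums of seminorms and their convexity defects -/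

/-- The `ℓ²`-sum of two seminorms. -/
noncomputable def sqAdd (a b : Seminorm ℝ X) : Seminorm ℝ X :=
  Seminorm.of (fun x => √(a x ^ 2 + b x ^ 2))
    (fun x y => by
      have h1 := map_add_le_add a x y
      have h2 := map_add_le_add b x y
      have e1 := Real.sq_sqrt (show 0 ≤ a x ^ 2 + b x ^ 2 by positivity)
      have e2 := Real.sq_sqrt (show 0 ≤ a y ^ 2 + b y ^ 2 by positivity)
      have p1 := Real.sqrt_nonneg (a x ^ 2 + b x ^ 2)
      have p2 := Real.sqrt_nonneg (a y ^ 2 + b y ^ 2)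
      have hc : a x * a y + b x * b y ≤ √(a x ^ 2 + b x ^ 2) * √(a y ^ 2 + b y ^ 2) := by
        refine le_of_abs_le (abs_le_of_sq_le_sq ?_ (by positivity))
        rw [mul_pow, e1, e2]
        nlinarith [sq_nonneg (a x * b y - b x * a y)]
      refine Real.sqrt_le_iff.2 ⟨by positivity, ?_⟩
      have h1' : a (x + y) ^ 2 ≤ (a x + a y) ^ 2 := by gcongr
      have h2' : b (x + y) ^ 2 ≤ (b x + b y) ^ 2 := by gcongr
      nlinarith)
    (fun r x => by
      rw [map_smul_eq_mul, map_smul_eq_mul, mul_pow, mul_pow, ← mul_add,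
        Real.sqrt_mul (by positivity), Real.sqrt_sq (norm_nonneg r)])

theorem sqAdd_sq (a b : Seminorm ℝ X) (x : X) : sqAdd a b x ^ 2 = a x ^ 2 + b x ^ 2 :=
  Real.sq_sqrt (by positivity)

theorem sqAdd_le (a b : Seminorm ℝ X) (x : X) : sqAdd a b x ≤ a x + b x := by
  refine le_of_abs_le (abs_le_of_sq_le_sq ?_ (by positivity))
  rw [sqAdd_sq]
  nlinarith [apply_nonneg a x, apply_nonneg b x]

theorem le_sqAdd_left (a b : Seminorm ℝ X) (x : X) : a x ≤ sqAdd a b x := by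
  refine le_of_abs_le (abs_le_of_sq_le_sq ?_ (by positivity))
  rw [sqAdd_sq]
  nlinarith [sq_nonneg (b x)]

/-- The multiple `t • a` of a seminorm by a real number. -/
noncomputable def scale (t : ℝ) (a : Seminorm ℝ X) : Seminorm ℝ X :=
  a.comp (t • LinearMap.id)

theorem scale_apply (t : ℝ) (a : Seminorm ℝ X) (x : X) : scale t a x = |t| * a x := by
  simp [scale, map_smul_eq_mul]

/-- The convexity defect of the square of a seminorm at the midpoint of `x` and `y`. -/
noncomputable def defect (a : Seminorm ℝ X) (x y : X) : ℝ :=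
  (a x ^ 2 + a y ^ 2) / 2 - a ((2⁻¹ : ℝ) • (x + y)) ^ 2

theorem map_midpoint_le (a : Seminorm ℝ X) (x y : X) :
    a ((2⁻¹ : ℝ) • (x + y)) ≤ (a x + a y) / 2 := by
  have := map_add_le_add a x y
  rw [map_smul_eq_mul]
  norm_num
  linarith

/-- The midpoint value is at most the mean of `a x` and `a y`, and the variance of two numbers is
the square of half their difference. A small defect therefore makes the two values almost equal. -/
theorem sq_sub_le_defect (a : Seminorm ℝ X) (x y : X) :
    ((a x - a y) / 2) ^ 2 ≤ defect a x y := by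
  have h := map_midpoint_le a x y
  have h' : a ((2⁻¹ : ℝ) • (x + y)) ^ 2 ≤ ((a x + a y) / 2) ^ 2 := by gcongr
  unfold defect
  nlinarith

theorem defect_nonneg (a : Seminorm ℝ X) (x y : X) : 0 ≤ defect a x y :=
  (sq_nonneg _).trans (sq_sub_le_defect a x y)

theorem defect_sqAdd (a b : Seminorm ℝ X) (x y : X) :
    defect (sqAdd a b) x y = defect a x y + defect b x y := by
  simp only [defect, sqAdd_sq]
  ring

theorem defect_scale (t : ℝ) (a : Seminorm ℝ X) (x y : X) :
    defect (scale t a) x y = t ^ 2 * defect a x y := by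
  simp only [defect, scale_apply, mul_pow, sq_abs]
  ring

theorem defect_comp (a : Seminorm ℝ X) (f : X →ₗ[ℝ] X) (x y : X) :
    defect (a.comp f) x y = defect a (f x) (f y) := by
  simp [defect]

/-- For a seminorm coming from a map into an inner product space, the defect is
the one of the parallelogram law. -/
theorem defect_inner {H : Type*} [NormedAddCommGroup H] [InnerProductSpace ℝ H] (S : X →ₗ[ℝ] H)
    (x y : X) : defect ((normSeminorm ℝ H).comp S) x y = ‖S (y - x)‖ ^ 2 / 4 := by
  have h := parallelogram_law_with_norm ℝ (S x) (S y)
  have h2 : ‖S (y - x)‖ = ‖S x - S y‖ := by rw [map_sub, norm_sub_rev]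
  rw [h2]
  simp only [defect, Seminorm.comp_apply, coe_normSeminorm, map_smul, map_add, norm_smul]
  norm_num
  linarith

/-! ### Upper limits of seminorms -/

/-- The pointwise upper limit of a pointwise bounded sequence of seminorms. -/
noncomputable def limsupSeminorm (a : ℕ → Seminorm ℝ X) (h : ∀ x, ∃ M, ∀ n, a n x ≤ M) :
    Seminorm ℝ X :=
  have hb : ∀ x, IsBoundedUnder (· ≤ ·) atTop fun n => a n x := fun x =>
    let ⟨M, hM⟩ := h x; isBoundedUnder_of ⟨M, hM⟩
  have hc : ∀ x, IsCoboundedUnder (· ≤ ·) atTop fun n => a n x := fun x =>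
    (isBoundedUnder_of ⟨0, fun n => apply_nonneg (a n) x⟩ :
      IsBoundedUnder (· ≥ ·) atTop fun n => a n x).isCoboundedUnder_le
  Seminorm.ofSMulLE (fun x => limsup (fun n => a n x) atTop) (by simp)
    (fun x y => by
      refine le_of_forall_pos_le_add fun t ht => limsup_le_of_le (hc _) ?_
      filter_upwards [eventually_lt_of_limsup_lt
          (lt_add_of_pos_right (limsup (fun n => a n x) atTop) (half_pos ht)) (hb x),
        eventually_lt_of_limsup_lt
          (lt_add_of_pos_right (limsup (fun n => a n y) atTop) (half_pos ht)) (hb y)] with n h1 h2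
      linarith [map_add_le_add (a n) x y])
    (fun r x => by
      refine le_of_forall_pos_le_add fun t ht => limsup_le_of_le (hc _) ?_
      have ht' : 0 < t / (‖r‖ + 1) := by positivity
      filter_upwards [eventually_lt_of_limsup_lt
          (lt_add_of_pos_right (limsup (fun n => a n x) atTop) ht') (hb x)] with n h1
      rw [map_smul_eq_mul]
      calc ‖r‖ * a n x ≤ ‖r‖ * (limsup (fun n => a n x) atTop + t / (‖r‖ + 1)) := by gcongr
        _ = ‖r‖ * limsup (fun n => a n x) atTop + t * (‖r‖ / (‖r‖ + 1)) := by ring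
        _ ≤ ‖r‖ * limsup (fun n => a n x) atTop + t * 1 := by
            gcongr
            rw [div_le_one (by positivity)]
            linarith
        _ = _ := by ring)

theorem limsupSeminorm_le {a : ℕ → Seminorm ℝ X} (h : ∀ x, ∃ M, ∀ n, a n x ≤ M) {x : X} {c : ℝ}
    (hc : ∀ᶠ n in atTop, a n x ≤ c) : limsupSeminorm a h x ≤ c :=
  limsup_le_of_le (isBoundedUnder_of ⟨0, fun n => apply_nonneg (a n) x⟩ :
      IsBoundedUnder (· ≥ ·) atTop fun n => a n x).isCoboundedUnder_le hc

theorem eventually_lt_of_limsupSeminorm_lt {a : ℕ → Seminorm ℝ X} (h : ∀ x, ∃ M, ∀ n, a n x ≤ M)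
    {x : X} {c : ℝ} (hc : limsupSeminorm a h x < c) : ∀ᶠ n in atTop, a n x < c :=
  eventually_lt_of_limsup_lt hc (let ⟨M, hM⟩ := h x; isBoundedUnder_of ⟨M, hM⟩)

/-! ### Rotundity expressed through the defect -/

theorem tendsto_of_defect {N : Seminorm ℝ X} {x y : ℕ → X} {a : ℝ}
    (hD : Tendsto (fun n => defect N (x n) (y n)) atTop (𝓝 0))
    (hx : Tendsto (fun n => N (x n)) atTop (𝓝 a)) :
    Tendsto (fun n => N (y n)) atTop (𝓝 a) ∧
      Tendsto (fun n => N ((2⁻¹ : ℝ) • (x n + y n))) atTop (𝓝 a) := by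
  have ha : 0 ≤ a := ge_of_tendsto' hx fun n => apply_nonneg N (x n)
  have h1 : Tendsto (fun n => ((N (x n) - N (y n)) / 2) ^ 2) atTop (𝓝 0) :=
    squeeze_zero (fun n => sq_nonneg _) (fun n => sq_sub_le_defect N _ _) hD
  have h2 : Tendsto (fun n => (N (x n) - N (y n)) / 2) atTop (𝓝 0) := by
    refine (tendsto_zero_iff_abs_tendsto_zero _).2 ?_
    have := h1.sqrt
    simpa [Real.sqrt_sq_eq_abs, Function.comp_def] using this
  have hy : Tendsto (fun n => N (y n)) atTop (𝓝 a) := by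
    have := hx.sub (h2.const_mul 2)
    simp only [mul_zero, sub_zero] at this
    refine this.congr fun n => by ring
  refine ⟨hy, ?_⟩
  have := (((((hx.pow 2).add (hy.pow 2)).div_const 2).sub hD)).sqrt
  rw [show √((a ^ 2 + a ^ 2) / 2 - 0) = a by rw [← Real.sqrt_sq ha]; congr 1; rw [Real.sqrt_sq ha]; ring] at this
  refine this.congr fun n => ?_
  simp only [defect, sub_sub_cancel]
  exact Real.sqrt_sq (apply_nonneg _ _)

/-- This frees URED from the unit ball: one `δ` serves all points of a bounded set, which gives
control uniform in the index of the family. Along a subsequence of counterexamples the values of `N`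
converge to some `a`; for `a = 0` the differences vanish, and for `a > 0` rescaling returns to the
unit ball. -/
theorem IsURED.exists_defect {N : Seminorm ℝ X} (hN : IsURED N) (hpos : ∀ x, N x = 0 → x = 0)
    {v : X} (hv : v ≠ 0) {ε : ℝ} (hε : 0 < ε) (R : ℝ) :
    ∃ δ > 0, ∀ (x y : X) (c : ℝ), N x ≤ R → y - x = c • v → defect N x y < δ → |c| < ε := by
  have hNv : 0 < N v := (apply_nonneg N v).lt_of_ne' fun h => hv (hpos v h)
  by_contra! H
  choose x y c hxR hxy hD hc using fun n : ℕ =>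
    H (1 / ((n : ℝ) + 1)) (by positivity)
  obtain ⟨a, -, φ, hφ, hx⟩ := tendsto_subseq_of_bounded (Metric.isBounded_Icc 0 R)
    (fun n => (⟨apply_nonneg N (x n), hxR n⟩ : N (x n) ∈ Set.Icc 0 R))
  have hD0 : Tendsto (fun n => defect N (x n) (y n)) atTop (𝓝 0) :=
    squeeze_zero (fun n => defect_nonneg N _ _) (fun n => (hD n).le)
      tendsto_one_div_add_atTop_nhds_zero_nat
  obtain ⟨hy, hm⟩ := tendsto_of_defect (x := x ∘ φ) (y := y ∘ φ) (hD0.comp hφ.tendsto_atTop) hx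
  have hxy' : ∀ n, N (y n - x n) = |c n| * N v := fun n => by
    rw [hxy, map_smul_eq_mul, Real.norm_eq_abs]
  have key : ¬ Tendsto (fun n => |c (φ n)| * N v) atTop (𝓝 0) := fun h => by
    have := ge_of_tendsto' h (fun n => mul_le_mul_of_nonneg_right (hc (φ n)) hNv.le)
    nlinarith
  have ha : 0 ≤ a := ge_of_tendsto' hx fun n => apply_nonneg N _
  rcases ha.eq_or_lt with rfl | ha
  · refine key (squeeze_zero (fun n => by positivity) (fun n => ?_) (by simpa using hy.add hx))
    rw [← hxy']
    exact map_sub_le_add N _ _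
  -- Dividing by the larger of the two norms keeps both points in the ball and their difference
  -- parallel to `v`. If `M n = 0`, the convention `0⁻¹ = 0` is harmless, since this happens only
  -- finitely often.
  · set M : ℕ → ℝ := fun n => max (N (x (φ n))) (N (y (φ n))) with hM
    have hMa : Tendsto M atTop (𝓝 a) := by simpa using Tendsto.max hx hy
    have hM0 : ∀ n, 0 ≤ M n := fun n => le_max_of_le_left (apply_nonneg _ _)
    have hMi : Tendsto (fun n => (M n)⁻¹) atTop (𝓝 a⁻¹) := hMa.inv₀ ha.ne'
    have hmid : ∀ n, (2⁻¹ : ℝ) • ((M n)⁻¹ • x (φ n) + (M n)⁻¹ • y (φ n)) =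
        (M n)⁻¹ • ((2⁻¹ : ℝ) • (x (φ n) + y (φ n))) := fun n => by
      rw [← smul_add, smul_comm]
    have h := hN ((N v)⁻¹ • v) (by rw [map_smul_eq_mul, norm_inv, Real.norm_of_nonneg hNv.le, inv_mul_cancel₀ hNv.ne'])
      (fun n => (M n)⁻¹ • x (φ n)) (fun n => (M n)⁻¹ • y (φ n))
      (fun n => (M n)⁻¹ * (c (φ n) * N v))
      (fun n => by
        rw [map_smul_eq_mul, norm_inv, Real.norm_of_nonneg (hM0 n)]
        exact inv_mul_le_one_of_le₀ (le_max_left _ _) (hM0 n))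
      (fun n => by
        rw [map_smul_eq_mul, norm_inv, Real.norm_of_nonneg (hM0 n)]
        exact inv_mul_le_one_of_le₀ (le_max_right _ _) (hM0 n))
      (fun n => by
        rw [← smul_sub, hxy, smul_smul, smul_smul]
        congr 1
        field_simp)
      (by
        have := hMi.mul hm
        rw [inv_mul_cancel₀ ha.ne'] at this
        refine this.congr fun n => ?_
        rw [hmid, map_smul_eq_mul _ (M n)⁻¹, norm_inv, Real.norm_of_nonneg (hM0 n)]
        rfl)
    apply key
    have h2 := (h.mul hMa).abs
    simp only [zero_mul, abs_zero] at h2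
    refine h2.congr' ?_
    filter_upwards [hMa.eventually_ne ha.ne'] with n hn
    rw [mul_assoc, mul_comm _ (M n), inv_mul_cancel_left₀ hn, abs_mul, abs_of_pos hNv]

theorem IsLUR.exists_defect {N : Seminorm ℝ X} (hN : IsLUR N) (x : X) {ε : ℝ} (hε : 0 < ε) :
    ∃ δ > 0, ∀ y : X, defect N x y < δ → N (x - y) < ε := by
  by_contra! H
  choose y hD hc using fun n : ℕ => H (1 / ((n : ℝ) + 1)) (by positivity)
  have hD0 : Tendsto (fun n => defect N x (y n)) atTop (𝓝 0) :=
    squeeze_zero (fun n => defect_nonneg N _ _) (fun n => (hD n).le)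
      tendsto_one_div_add_atTop_nhds_zero_nat
  obtain ⟨hy, hm⟩ := tendsto_of_defect (x := fun _ => x) hD0 tendsto_const_nhds
  have key : ¬ Tendsto (fun n => N (x - y n)) atTop (𝓝 0) := fun h => by
    linarith [ge_of_tendsto' h hc]
  apply key
  rcases (apply_nonneg N x).eq_or_lt with ha | ha
  · rw [← ha] at hy
    refine squeeze_zero (fun n => apply_nonneg N _) (fun n => map_sub_le_add N _ _) ?_
    simpa [← ha] using hy
  · set a := N x with hadef
    set M : ℕ → ℝ := fun n => max a (N (y n)) with hM
    have hMa : Tendsto M atTop (𝓝 a) := by simpa using (tendsto_const_nhds (x := a)).max hy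
    have hMp : ∀ n, 0 < M n := fun n => lt_max_of_lt_left ha
    have hMi : Tendsto (fun n => (M n)⁻¹) atTop (𝓝 a⁻¹) := hMa.inv₀ ha.ne'
    have hxn : N (a⁻¹ • x) = 1 := by
      rw [map_smul_eq_mul, norm_inv, Real.norm_of_nonneg ha.le, ← hadef, inv_mul_cancel₀ ha.ne']
    have hr : Tendsto (fun n => |(M n)⁻¹ - a⁻¹| * N (y n)) atTop (𝓝 0) := by
      simpa using (hMi.sub_const a⁻¹).abs.mul hy
    -- LUR needs a fixed centre, so `x` is scaled by `a⁻¹` and only `y n` by `(M n)⁻¹`. The mismatch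
    -- is at most `|(M n)⁻¹ - a⁻¹| * N (y n)`, which tends to zero by `hr`.
    have h := hN (a⁻¹ • x) hxn (fun n => (M n)⁻¹ • y n)
      (fun n => by
        rw [map_smul_eq_mul, norm_inv, Real.norm_of_nonneg (hMp n).le]
        exact inv_mul_le_one_of_le₀ (le_max_right _ _) (hMp n).le)
      (by
        have h1 := hm.const_mul a⁻¹
        rw [inv_mul_cancel₀ ha.ne'] at h1
        refine (tendsto_iff_of_dist (f₁ := fun n => a⁻¹ * N ((2⁻¹ : ℝ) • (x + y n))) ?_).1 ?_
        swap
        · exact h1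
        · refine squeeze_zero (fun n => dist_nonneg) (fun n => ?_) hr
          rw [Real.dist_eq]
          have e : N (a⁻¹ • ((2⁻¹ : ℝ) • (x + y n))) = a⁻¹ * N ((2⁻¹ : ℝ) • (x + y n)) := by
            rw [map_smul_eq_mul, norm_inv, Real.norm_of_nonneg ha.le]
          rw [← e]
          rw [abs_sub_comm]
          refine (abs_sub_map_le_sub N _ _).trans ?_
          rw [show (2⁻¹ : ℝ) • (a⁻¹ • x + (M n)⁻¹ • y n) - a⁻¹ • ((2⁻¹ : ℝ) • (x + y n)) =
            (2⁻¹ * ((M n)⁻¹ - a⁻¹)) • y n by module, map_smul_eq_mul, norm_mul]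
          norm_num
          nlinarith [abs_nonneg ((M n)⁻¹ - a⁻¹), apply_nonneg N (y n),
            mul_nonneg (abs_nonneg ((M n)⁻¹ - a⁻¹)) (apply_nonneg N (y n))])
    refine squeeze_zero (fun n => apply_nonneg N _) (fun n => ?_)
      (by simpa using (h.add hr).const_mul a)
    have e : x - y n = a • ((a⁻¹ • x - (M n)⁻¹ • y n) + ((M n)⁻¹ - a⁻¹) • y n) := by
      have : a • a⁻¹ = (1 : ℝ) := by simp [ha.ne']
      rw [show a • ((a⁻¹ • x - (M n)⁻¹ • y n) + ((M n)⁻¹ - a⁻¹) • y n) =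
        (a • a⁻¹) • (x - y n) by module, this, one_smul]
    rw [e, map_smul_eq_mul, Real.norm_of_nonneg ha.le]
    gcongr
    refine (map_add_le_add N _ _).trans ?_
    rw [map_smul_eq_mul, Real.norm_eq_abs]

/-! ### Bounded biorthogonal systems in infinite dimension -/

theorem not_finiteDimensional_ker {F : Type*} [AddCommGroup F] [Module ℝ F]
    [FiniteDimensional ℝ F] (hdim : ¬ FiniteDimensional ℝ X) (T : X →ₗ[ℝ] F) :
    ¬ FiniteDimensional ℝ (LinearMap.ker T) := fun h => by
  have : FiniteDimensional ℝ (X ⧸ LinearMap.ker T) :=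
    Module.Finite.equiv T.quotKerEquivRange.symm
  exact hdim (Module.Finite.of_submodule_quotient (LinearMap.ker T))

/-- An infinite-dimensional subspace contains bounded vectors far from a given
finite-dimensional subspace. -/
theorem exists_mem_infDist_ge {Z : Submodule ℝ X} (hZ : ¬ FiniteDimensional ℝ Z)
    (E : Submodule ℝ X) [FiniteDimensional ℝ E] :
    ∃ w ∈ Z, ‖w‖ ≤ 3 ∧ 1 / 4 ≤ Metric.infDist w E := by
  obtain ⟨g, hg3, hg1⟩ := exists_seq_norm_le_one_le_norm_sub' (𝕜 := ℝ) (c := 2) (R := 3)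
    (by norm_num) (by norm_num) hZ
  -- If every term of the 1-separated sequence `g` were within 1/4 of `E`, compactness would bring
  -- two of the approximants within 1/4 of each other, and the corresponding terms of `g` within
  -- 3/4.
  by_contra! H
  have hne : (E : Set X).Nonempty := ⟨0, E.zero_mem⟩
  choose y hyE hy using fun n => (Metric.infDist_lt_iff hne).1 (H (g n) (g n).2 (hg3 n))
  have hyb : ∀ n, (⟨y n, hyE n⟩ : E) ∈ Metric.closedBall (0 : E) 4 := fun n => by
    rw [mem_closedBall_zero_iff]
    change ‖y n‖ ≤ 4
    have h1 : ‖(g n : X)‖ ≤ 3 := hg3 n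
    have h2 := hy n
    rw [dist_eq_norm] at h2
    have := norm_sub_norm_le (y n) (g n)
    rw [norm_sub_rev] at this
    linarith
  obtain ⟨z, -, ψ, hψ, hz⟩ := (isCompact_closedBall (0 : E) 4).tendsto_subseq hyb
  obtain ⟨k, hk⟩ := Metric.cauchySeq_iff.1 hz.cauchySeq (1 / 4) (by norm_num)
  have h1 := hk k le_rfl (k + 1) (Nat.le_succ k)
  have h2 : 1 ≤ ‖(g (ψ k) : X) - g (ψ (k + 1))‖ := hg1 (hψ (Nat.lt_succ_self k)).ne
  have h3 : dist (y (ψ k)) (y (ψ (k + 1))) < 1 / 4 := h1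
  have h4 := hy (ψ k)
  have h5 := hy (ψ (k + 1))
  rw [← dist_eq_norm] at h2
  have := dist_triangle4 (g (ψ k) : X) (y (ψ k)) (y (ψ (k + 1))) (g (ψ (k + 1)))
  rw [dist_comm (y (ψ (k + 1)))] at this
  linarith

/-- Hahn–Banach in the quotient by `E`, where the norm of the class of `w` is its distance to `E`.
-/
theorem exists_dual_eq_infDist (E : Submodule ℝ X) [FiniteDimensional ℝ E] (w : X) :
    ∃ φ : X →L[ℝ] ℝ, (∀ x, |φ x| ≤ ‖x‖) ∧ (∀ x ∈ E, φ x = 0) ∧ φ w = Metric.infDist w E := by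
  have : IsClosed (E : Set X) := E.closed_of_finiteDimensional
  obtain ⟨g, hg, hgw⟩ := exists_dual_vector'' ℝ (E.mkQ w)
  have hb : ∀ x, |g (E.mkQ x)| ≤ ‖x‖ := fun x => by
    calc |g (E.mkQ x)| ≤ 1 * ‖E.mkQ x‖ := g.le_of_opNorm_le hg _
      _ ≤ ‖x‖ := by rw [one_mul]; exact Submodule.Quotient.norm_mk_le E x
  refine ⟨(g.toLinearMap ∘ₗ E.mkQ).mkContinuous 1 fun x => by rw [one_mul]; exact hb x, hb,
    fun x hx => ?_, ?_⟩
  · have : E.mkQ x = 0 := by simpa using hx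
    change g (E.mkQ x) = 0
    rw [this, map_zero]
  · change g (E.mkQ w) = _
    rw [hgw]
    exact QuotientAddGroup.norm_mk w

theorem exists_dual_eq_seminorm {p : Seminorm ℝ X} (hp : Continuous p) {b : X} (hb : p b = 1) :
    ∃ B : X →L[ℝ] ℝ, B b = 1 ∧ ∀ x, |B x| ≤ p x := by
  have hb0 : b ≠ 0 := fun h => by simp [h] at hb
  let g := (LinearEquiv.toSpanNonzeroSingleton ℝ X b hb0).symm
  obtain ⟨B, hB, hBp⟩ := Module.Dual.exists_continuous_extension_of_le_seminorm_real
    (Submodule.span ℝ {b}) g.toLinearMap hp (fun x => by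
      obtain ⟨t, rfl⟩ := g.symm.surjective x
      have : ((g.symm t : Submodule.span ℝ {b}) : X) = t • b := rfl
      rw [this, map_smul_eq_mul, hb, mul_one]
      simpa using le_abs_self t)
  refine ⟨B, ?_, hBp⟩
  have := hB (g.symm 1)
  have h1 : ((g.symm 1 : Submodule.span ℝ {b}) : X) = b := one_smul ℝ b
  rw [h1] at this
  simpa using this

theorem IsEquivalentNorm.continuous {p : Seminorm ℝ X} (hp : IsEquivalentNorm p) :
    Continuous p := by
  obtain ⟨a, b, -, hb, h⟩ := hp
  refine Seminorm.continuous_of_continuousAt_zero ?_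
  rw [ContinuousAt, map_zero]
  refine squeeze_zero (fun x => apply_nonneg p x) (fun x => (h x).2) ?_
  exact Continuous.tendsto' (by fun_prop) _ _ (by simp)

theorem IsEquivalentNorm.eq_zero {p : Seminorm ℝ X} (hp : IsEquivalentNorm p) {x : X}
    (h : p x = 0) : x = 0 := by
  obtain ⟨a, b, ha, hb, hab⟩ := hp
  have := (hab x).1
  rw [h] at this
  exact norm_le_zero_iff.1 (nonpos_of_mul_nonpos_right this ha)

theorem IsEquivalentNorm.exists_mem_eq_one {p : Seminorm ℝ X} (hp : IsEquivalentNorm p)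
    {Z : Submodule ℝ X} (hZ : ¬ FiniteDimensional ℝ Z) : ∃ x ∈ Z, p x = 1 := by
  obtain ⟨x, hx, h0⟩ : ∃ x ∈ Z, x ≠ 0 := by
    refine Z.ne_bot_iff.1 fun h => hZ ?_
    rw [h]
    infer_instance
  have h1 : p x ≠ 0 := fun h => h0 (hp.eq_zero h)
  refine ⟨(p x)⁻¹ • x, Z.smul_mem _ hx, ?_⟩
  rw [map_smul_eq_mul, norm_inv, Real.norm_of_nonneg (apply_nonneg p x), inv_mul_cancel₀ h1]

/-- A bounded biorthogonal sequence `(w, φ)`, together with two further vectors `b`, `e` and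
functionals `B`, `f`, where `B` supports the unit ball of `p` at `b`. -/
structure BiorthogonalSystem (p : Seminorm ℝ X) where
  C : ℝ
  b : X
  e : X
  B : X →L[ℝ] ℝ
  f : X →L[ℝ] ℝ
  w : ℕ → X
  φ : ℕ → X →L[ℝ] ℝ
  one_le_C : 1 ≤ C
  p_b : p b = 1
  p_e : p e = 1
  B_b : B b = 1
  B_e : B e = 0
  f_e : f e = 1
  B_le : ∀ x, |B x| ≤ p x
  p_w : ∀ n, p (w n) ≤ 1
  B_w : ∀ n, B (w n) = 0
  f_w : ∀ n, f (w n) = 0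
  φ_b : ∀ n, φ n b = 0
  φ_e : ∀ n, φ n e = 0
  φ_le : ∀ n x, |φ n x| ≤ C * p x
  φ_self : ∀ n, φ n (w n) = 1
  φ_ne : ∀ {m n}, m ≠ n → φ m (w n) = 0

theorem exists_biorthogonalSystem (hdim : ¬ FiniteDimensional ℝ X) {p : Seminorm ℝ X}
    (hp : IsEquivalentNorm p) : Nonempty (BiorthogonalSystem p) := by
  have hp' := hp
  obtain ⟨α, β, hα, hβ, hab⟩ := hp'
  -- The kernel of the zero map is all of `X`; any unit vector will do.
  obtain ⟨b, -, hb⟩ := hp.exists_mem_eq_one (not_finiteDimensional_ker hdim (0 : X →ₗ[ℝ] ℝ))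
  obtain ⟨B, hBb, hBp⟩ := exists_dual_eq_seminorm hp.continuous hb
  obtain ⟨e, heB, he⟩ := hp.exists_mem_eq_one (not_finiteDimensional_ker hdim B.toLinearMap)
  obtain ⟨f, hfe, -⟩ := exists_dual_eq_seminorm hp.continuous he
  obtain ⟨u, hu, hr⟩ := exists_seq_of_forall_finset_exists
    (fun u : X × (X →L[ℝ] ℝ) => p u.1 ≤ 1 ∧ B u.1 = 0 ∧ f u.1 = 0 ∧ u.2 b = 0 ∧ u.2 e = 0 ∧
      (∀ x, |u.2 x| ≤ max 1 (12 * β / α) * p x) ∧ u.2 u.1 = 1)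
    (fun u u' => u.2 u'.1 = 0 ∧ u'.2 u.1 = 0) (by
      intro s _
      let T : X →ₗ[ℝ] (ℝ × ℝ) × (s → ℝ) :=
        (B.toLinearMap.prod f.toLinearMap).prod (LinearMap.pi fun u => u.1.2.toLinearMap)
      classical
      let A : Finset X := {b, e} ∪ s.image Prod.fst
      let E : Submodule ℝ X := Submodule.span ℝ (A : Set X)
      -- Choosing `w` in the kernel of all earlier functionals, and the new functional zero on all
      -- earlier vectors, gives both halves of biorthogonality. The distance bound keeps the
      -- functionals uniformly bounded.
      obtain ⟨w, hwT, hw3, hwE⟩ := exists_mem_infDist_ge (not_finiteDimensional_ker hdim T) E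
      set d := Metric.infDist w E
      have hd : 0 < d := by linarith
      obtain ⟨ψ, hψ, hψE, hψw⟩ := exists_dual_eq_infDist E w
      have hψw : ψ w = d := hψw
      have hT : ((B w, f w), fun u : s => u.1.2 w) = (0 : (ℝ × ℝ) × (s → ℝ)) := hwT
      simp only [Prod.mk_eq_zero] at hT
      obtain ⟨⟨hBw, hfw⟩, hsw⟩ := hT
      have hA : ∀ x ∈ A, ψ x = 0 := fun x hx => hψE x (Submodule.subset_span hx)
      have ht : (0 : ℝ) < 12 * β := by positivity
      -- The factor `12` is the ratio of `‖w‖ ≤ 3` to `d ≥ 1 / 4`: it gives `p` of the new vector at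
      -- most `1` while the pairing is exactly `1`.
      refine ⟨((12 * β * d)⁻¹ • w, (12 * β) • ψ), ⟨?_, ?_, ?_, ?_, ?_, fun x => ?_, ?_⟩,
        fun u hus => ⟨?_, ?_⟩⟩
      · rw [map_smul_eq_mul, Real.norm_of_nonneg (by positivity)]
        rw [inv_mul_le_one₀ (by positivity)]
        have := (hab w).2
        nlinarith
      · simp [hBw]
      · simp [hfw]
      · simp [hA b (by simp [A])]
      · simp [hA e (by simp [A])]
      · have h1 := (hab x).1
        have h2 := hψ x
        have h3 : ‖x‖ ≤ p x / α := by rw [le_div_iff₀ hα]; linarith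
        calc |((12 * β) • ψ) x| = 12 * β * |ψ x| := by
              simp [abs_mul, abs_of_pos hβ]
          _ ≤ 12 * β * (p x / α) := by gcongr; linarith
          _ = 12 * β / α * p x := by ring
          _ ≤ _ := by gcongr; exact le_max_right _ _
      · simp [hψw]
        field_simp
      · have : u.2 w = 0 := congrFun hsw ⟨u, hus⟩
        simp [this]
      · have := hA u.1 (by exact Finset.mem_union_right _ (Finset.mem_image_of_mem _ hus))
        simp [this])
  exact ⟨{
    C := max 1 (12 * β / α), b := b, e := e, B := B, f := f
    w := fun n => (u n).1, φ := fun n => (u n).2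
    one_le_C := le_max_left _ _, p_b := hb, p_e := he, B_b := hBb, B_e := heB, f_e := hfe
    B_le := hBp
    p_w := fun n => (hu n).1, B_w := fun n => (hu n).2.1, f_w := fun n => (hu n).2.2.1
    φ_b := fun n => (hu n).2.2.2.1, φ_e := fun n => (hu n).2.2.2.2.1
    φ_le := fun n => (hu n).2.2.2.2.2.1, φ_self := fun n => (hu n).2.2.2.2.2.2
    φ_ne := fun {m n} h => (lt_or_gt_of_ne h).elim (fun h => (hr m n h).1)
      (fun h => (hr n m h).2) }⟩

namespace BiorthogonalSystem

variable {p : Seminorm ℝ X} (s : BiorthogonalSystem p)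

/-- The directions that are asymptotically contained in the unit sphere of the new norm. -/
def v (n : ℕ) : X := s.e + s.w (n + 1)

theorem p_v_le (n : ℕ) : p (s.v n) ≤ 2 := by
  have := map_add_le_add p s.e (s.w (n + 1))
  have := s.p_w (n + 1)
  have := s.p_e
  unfold v
  linarith

theorem B_v (n : ℕ) : s.B (s.v n) = 0 := by simp [v, s.B_e, s.B_w]

theorem f_v (n : ℕ) : s.f (s.v n) = 1 := by simp [v, s.f_e, s.f_w]

theorem φ_v_self (n : ℕ) : s.φ (n + 1) (s.v n) = 1 := by simp [v, s.φ_e, s.φ_self]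

theorem φ_v_of_ne {m n : ℕ} (h : m ≠ n + 1) : s.φ m (s.v n) = 0 := by
  simp [v, s.φ_e, s.φ_ne h]

theorem summable_sq (x : X) : (Summable fun j => ‖(1 / 2 : ℝ) ^ j * s.φ j x‖ ^ (2 : ℝ)) ∧
    ∑' j, ‖(1 / 2 : ℝ) ^ j * s.φ j x‖ ^ (2 : ℝ) ≤ (2 * s.C * p x) ^ 2 := by
  have h1 : ∀ j, ‖(1 / 2 : ℝ) ^ j * s.φ j x‖ ^ (2 : ℝ) ≤ (1 / 2 : ℝ) ^ j * (s.C * p x) ^ 2 := by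
    intro j
    rw [Real.rpow_two, norm_mul, mul_pow, Real.norm_of_nonneg (by positivity)]
    have h2 : ‖s.φ j x‖ ^ 2 ≤ (s.C * p x) ^ 2 := by
      gcongr
      exact s.φ_le j x
    have h3 : ((1 / 2 : ℝ) ^ j) ^ 2 ≤ (1 / 2 : ℝ) ^ j := by
      rw [sq]
      exact mul_le_of_le_one_left (by positivity) (pow_le_one₀ (by norm_num) (by norm_num))
    gcongr
  have h2 : Summable fun j => (1 / 2 : ℝ) ^ j * (s.C * p x) ^ 2 :=
    (summable_geometric_of_lt_one (by norm_num) (by norm_num)).mul_right _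
  have h3 := Summable.of_nonneg_of_le (fun j => by positivity) h1 h2
  refine ⟨h3, (h3.tsum_le_tsum h1 h2).trans ?_⟩
  rw [tsum_mul_right, tsum_geometric_of_lt_one (by norm_num) (by norm_num)]
  nlinarith [sq_nonneg (s.C * p x)]

/-- The map `x ↦ (2⁻ʲ φⱼ(x))ⱼ` into `ℓ²`. -/
noncomputable def toL2 : X →ₗ[ℝ] lp (fun _ : ℕ => ℝ) 2 where
  toFun x := ⟨fun j => (1 / 2 : ℝ) ^ j * s.φ j x, memℓp_gen (by simpa using (s.summable_sq x).1)⟩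
  map_add' x y := by
    ext j
    change (1 / 2 : ℝ) ^ j * s.φ j (x + y) = (1 / 2 : ℝ) ^ j * s.φ j x + (1 / 2 : ℝ) ^ j * s.φ j y
    rw [map_add, mul_add]
  map_smul' c x := by
    ext j
    change (1 / 2 : ℝ) ^ j * s.φ j (c • x) = c * ((1 / 2 : ℝ) ^ j * s.φ j x)
    rw [map_smul, smul_eq_mul, mul_left_comm]

theorem toL2_apply (x : X) (j : ℕ) : s.toL2 x j = (1 / 2 : ℝ) ^ j * s.φ j x := rfl

theorem norm_toL2_le (x : X) : ‖s.toL2 x‖ ≤ 2 * s.C * p x := by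
  have := s.one_le_C
  refine lp.norm_le_of_tsum_le (by norm_num) (by positivity) ?_
  simpa [toL2_apply] using (s.summable_sq x).2

theorem toL2_b : s.toL2 s.b = 0 := by
  ext j
  simp [toL2_apply, s.φ_b]

theorem toL2_e : s.toL2 s.e = 0 := by
  ext j
  simp [toL2_apply, s.φ_e]

theorem norm_toL2_w_le (n : ℕ) : ‖s.toL2 (s.w n)‖ ≤ (1 / 2) ^ n := by
  refine lp.norm_le_of_tsum_le (by norm_num) (by positivity) ?_
  rw [tsum_eq_single n fun j hj => by simp [toL2_apply, s.φ_ne hj]]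
  simp [toL2_apply, s.φ_self]

end BiorthogonalSystem

/-! ### Construction of the new norm -/

/-- The parameters of the construction of the new norm out of the norm `p` to be approximated
and a rotund norm `N`. -/
structure RenormingData (p N : Seminorm ℝ X) extends BiorthogonalSystem p where
  M : ℝ
  r : ℝ
  δ : ℝ
  one_le_M : 1 ≤ M
  N_le : ∀ x, N x ≤ M * p x
  r_pos : 0 < r
  r_le_one : r ≤ 1
  δ_pos : 0 < δ
  -- The quantity `δ * (4 * C * M)` is `κ`, which bounds the auxiliary terms relative to `p`. The
  -- two conditions read `κ ≤ r`, for the approximation of `p`, and `36 * κ ^ 2 ≤ μ`, so that these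
  -- terms cannot fill the gaps of order `μ` between the pieces of the norm.
  δ_le : δ * (4 * C * M) ≤ r
  δ_sq_le : 36 * (δ * (4 * C * M)) ^ 2 ≤ r / C * r / 2

namespace RenormingData

variable {p N : Seminorm ℝ X} (D : RenormingData p N)

/-- The size of the perturbation of `B` by `φ n`. -/
noncomputable def ρ : ℝ := D.r / D.C

theorem C_pos : 0 < D.C := one_pos.trans_le D.one_le_C

theorem ρ_pos : 0 < D.ρ := div_pos D.r_pos D.C_pos

theorem ρ_mul_C : D.ρ * D.C = D.r := div_mul_cancel₀ _ D.C_pos.ne'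

theorem ρ_le : D.ρ ≤ D.r := div_le_self D.r_pos.le D.one_le_C

/-- The excess of `F n` at its peak `D.pt n`, halved. -/
noncomputable def μ : ℝ := D.ρ * D.r / 2

theorem μ_pos : 0 < D.μ := by
  have := D.ρ_pos
  have := D.r_pos
  unfold μ
  positivity

theorem μ_le : D.μ ≤ D.r / 2 := by
  have := D.ρ_le
  have := D.r_pos
  have := D.r_le_one
  unfold μ
  nlinarith

/-- The size of the perturbation by the auxiliary quadratic terms. -/
noncomputable def κ : ℝ := D.δ * (4 * D.C * D.M)

theorem κ_pos : 0 < D.κ := by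
  have := D.C_pos
  have := D.δ_pos
  have := one_pos.trans_le D.one_le_M
  unfold κ
  positivity

theorem κ_le : D.κ ≤ D.r := D.δ_le

theorem κ_sq_le : 36 * D.κ ^ 2 ≤ D.μ := D.δ_sq_le

/-- The cutting functionals. -/
noncomputable def F (n : ℕ) : X →ₗ[ℝ] ℝ := D.B.toLinearMap + D.ρ • (D.φ n).toLinearMap

theorem F_apply (n : ℕ) (x : X) : D.F n x = D.B x + D.ρ * D.φ n x := rfl

theorem abs_F_le (n : ℕ) (x : X) : |D.F n x| ≤ (1 + D.r) * p x := by
  rw [F_apply]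
  calc |D.B x + D.ρ * D.φ n x| ≤ |D.B x| + D.ρ * |D.φ n x| := by
        refine (abs_add_le _ _).trans ?_
        rw [abs_mul, abs_of_pos D.ρ_pos]
    _ ≤ p x + D.ρ * (D.C * p x) := by
        have := D.ρ_pos.le
        gcongr
        · exact D.B_le x
        · exact D.φ_le n x
    _ = (1 + D.r) * p x := by rw [← mul_assoc, ρ_mul_C]; ring

/-- The absolute value of `F n`, as a seminorm. -/
noncomputable def absF (n : ℕ) : Seminorm ℝ X := (normSeminorm ℝ ℝ).comp (D.F n)

theorem absF_apply (n : ℕ) (x : X) : D.absF n x = |D.F n x| := rfl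

theorem absF_bdd (x : X) : ∃ A, ∀ n, D.absF n x ≤ A := ⟨_, fun n => D.abs_F_le n x⟩

/-- The norm `p`, slightly shrunk, but large enough to dominate all but finitely many of the
`F n` at each point. -/
noncomputable def base : Seminorm ℝ X :=
  -- The first factor brings the segments through the peaks into the unit ball. The second lies
  -- strictly between `1`, as LUR requires, and the peak value `1 + 2 * D.μ`, as flatness requires.
  scale (1 + 2 * D.r)⁻¹ p ⊔ scale (1 + D.μ) (limsupSeminorm D.absF D.absF_bdd)

theorem base_apply (x : X) : D.base x =
    max ((1 + 2 * D.r)⁻¹ * p x) ((1 + D.μ) * limsupSeminorm D.absF D.absF_bdd x) := by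
  have := D.r_pos
  have := D.μ_pos
  rw [base, Seminorm.sup_apply, scale_apply, scale_apply, abs_of_pos (by positivity),
    abs_of_pos (by positivity)]

/-- The projection along `v n` with kernel spanned by `v n`. -/
noncomputable def proj (n : ℕ) : X →ₗ[ℝ] X :=
  LinearMap.id - (D.φ (n + 1)).toLinearMap.smulRight (D.v n)

theorem proj_apply (n : ℕ) (x : X) : D.proj n x = x - D.φ (n + 1) x • D.v n := rfl

theorem proj_v (n : ℕ) : D.proj n (D.v n) = 0 := by
  rw [proj_apply, D.φ_v_self, one_smul, sub_self]

theorem N_proj_le (n : ℕ) (x : X) : N (D.proj n x) ≤ 3 * D.C * D.M * p x := by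
  have hM := one_pos.trans_le D.one_le_M
  have hC := D.C_pos
  refine (D.N_le _).trans ?_
  have h1 : p (D.proj n x) ≤ p x + D.C * p x * 2 := by
    rw [proj_apply]
    refine (map_sub_le_add p _ _).trans ?_
    rw [map_smul_eq_mul]
    gcongr
    · exact D.φ_le _ x
    · exact D.p_v_le n
  have h2 : p x ≤ D.C * p x := le_mul_of_one_le_left (apply_nonneg p x) D.one_le_C
  calc D.M * p (D.proj n x) ≤ D.M * (3 * (D.C * p x)) := by gcongr; linarith
    _ = _ := by ring

/-- The seminorm `‖toL2 x‖`. -/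
noncomputable def T : Seminorm ℝ X := (normSeminorm ℝ _).comp D.toL2

theorem T_apply (x : X) : D.T x = ‖D.toL2 x‖ := rfl

/-- The weight of `N` in the member of the family with index `i`. -/
noncomputable def weight : Option ℕ → ℝ
  | none => D.δ
  | some n => D.δ / (n + 1)

/-- The auxiliary quadratic terms. -/
noncomputable def rest (n : ℕ) : Seminorm ℝ X :=
  sqAdd (scale D.δ (N.comp (D.proj n))) (sqAdd (scale D.δ D.T) (scale (D.weight (some n)) N))

theorem rest_sq (n : ℕ) (x : X) : D.rest n x ^ 2 = D.δ ^ 2 * N (D.proj n x) ^ 2 +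
    D.δ ^ 2 * ‖D.toL2 x‖ ^ 2 + D.δ ^ 2 * (N x / (n + 1)) ^ 2 := by
  simp only [rest, sqAdd_sq, scale_apply, mul_pow, sq_abs, T_apply, Seminorm.comp_apply, weight]
  ring

/-- The three terms contribute `9 + 4 + 1 ≤ 16` in units of `(δ C M p x) ^ 2`, whence the factor `4`
in `κ`. -/
theorem rest_le (n : ℕ) (x : X) : D.rest n x ≤ D.κ * p x := by
  have hκ := D.κ_pos
  have hM := one_pos.trans_le D.one_le_M
  have hC := D.C_pos
  refine le_of_abs_le (abs_le_of_sq_le_sq ?_ (by positivity))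
  rw [rest_sq]
  have h1 : N (D.proj n x) ^ 2 ≤ (3 * D.C * D.M * p x) ^ 2 := by
    gcongr
    exact D.N_proj_le n x
  have h2 : ‖D.toL2 x‖ ^ 2 ≤ (2 * D.C * D.M * p x) ^ 2 := by
    gcongr
    refine (D.norm_toL2_le x).trans ?_
    have hp := apply_nonneg p x
    gcongr ?_ * _
    exact le_mul_of_one_le_right (by positivity) D.one_le_M
  have h3 : (N x / (n + 1)) ^ 2 ≤ (1 * D.C * D.M * p x) ^ 2 := by
    gcongr
    refine (div_le_self (apply_nonneg N x) (by linarith [n.cast_nonneg (α := ℝ)])).trans ?_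
    refine (D.N_le x).trans ?_
    gcongr
    refine le_mul_of_one_le_left hM.le ?_
    rw [one_mul]
    exact D.one_le_C
  have e : (D.κ * p x) ^ 2 = D.δ ^ 2 * (16 * (D.C * D.M * p x) ^ 2) := by
    unfold κ
    ring
  rw [e, ← mul_add, ← mul_add]
  gcongr
  nlinarith [sq_nonneg (D.C * D.M * p x)]

theorem δ_N_le (x : X) : D.δ * N x ≤ D.κ * p x := by
  have hM := one_pos.trans_le D.one_le_M
  have hδ := D.δ_pos
  have h1 := D.N_le x
  have h2 : D.M * p x ≤ 4 * D.C * D.M * p x := by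
    gcongr
    exact le_mul_of_one_le_left hM.le (by linarith [D.one_le_C])
  calc D.δ * N x ≤ D.δ * (4 * D.C * D.M * p x) := by gcongr; linarith
    _ = _ := by unfold κ; ring

/-- The family of norms whose supremum is the new norm. -/
noncomputable def G : Option ℕ → Seminorm ℝ X
  | none => sqAdd D.base (scale D.δ N)
  | some n => sqAdd (D.absF n) (D.rest n)

theorem G_none_sq (x : X) : D.G none x ^ 2 = D.base x ^ 2 + (D.δ * N x) ^ 2 := by
  rw [G, sqAdd_sq, scale_apply, abs_of_pos D.δ_pos]

theorem G_some_sq (n : ℕ) (x : X) : D.G (some n) x ^ 2 = D.F n x ^ 2 + D.rest n x ^ 2 := by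
  rw [G, sqAdd_sq, absF_apply, sq_abs]

theorem base_le (x : X) : D.base x ≤ (1 + D.r) ^ 2 * p x := by
  have hr := D.r_pos
  have hμ := D.μ_pos
  have hμ' := D.μ_le
  have hp := apply_nonneg p x
  rw [base_apply]
  refine max_le ?_ ?_
  · have h1 : (1 + 2 * D.r)⁻¹ ≤ 1 := inv_le_one_of_one_le₀ (by linarith)
    have h2 : 1 ≤ (1 + D.r) ^ 2 := by nlinarith
    gcongr
    linarith
  · have h1 : limsupSeminorm D.absF D.absF_bdd x ≤ (1 + D.r) * p x :=
      limsupSeminorm_le _ (Eventually.of_forall fun n => D.abs_F_le n x)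
    calc (1 + D.μ) * limsupSeminorm D.absF D.absF_bdd x
        ≤ (1 + D.r) * ((1 + D.r) * p x) := by gcongr; linarith
      _ = _ := by ring

theorem G_le (i : Option ℕ) (x : X) : D.G i x ≤ (1 + 4 * D.r) * p x := by
  have hr := D.r_pos
  have hr1 := D.r_le_one
  have hp := apply_nonneg p x
  have hκ : D.κ * p x ≤ D.r * p x := by gcongr; exact D.κ_le
  rcases i with _ | n
  · refine (sqAdd_le _ _ x).trans ?_
    have h1 := D.base_le x
    have h2 := D.δ_N_le x
    rw [scale_apply, abs_of_pos D.δ_pos]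
    have h3 : D.r ^ 2 * p x ≤ D.r * p x := by gcongr; nlinarith
    nlinarith
  · refine (sqAdd_le _ _ x).trans ?_
    have h1 := D.abs_F_le n x
    have h2 := D.rest_le n x
    rw [absF_apply]
    nlinarith

theorem bddAbove_G (x : X) : BddAbove (Set.range fun i => D.G i x) :=
  ⟨_, Set.forall_mem_range.2 fun i => D.G_le i x⟩

/-- The new norm. -/
noncomputable def q : Seminorm ℝ X := ⨆ i, D.G i

theorem q_apply (x : X) : D.q x = ⨆ i, D.G i x :=
  Seminorm.iSup_apply (Seminorm.bddAbove_range_iff.2 D.bddAbove_G)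

theorem G_le_q (i : Option ℕ) (x : X) : D.G i x ≤ D.q x := by
  rw [q_apply]
  exact le_ciSup (D.bddAbove_G x) i

theorem q_le_of_forall {x : X} {c : ℝ} (h : ∀ i, D.G i x ≤ c) : D.q x ≤ c := by
  rw [q_apply]
  exact ciSup_le h

theorem exists_lt_of_lt_q {x : X} {c : ℝ} (h : c < D.q x) : ∃ i, c < D.G i x := by
  rw [q_apply] at h
  exact exists_lt_of_lt_ciSup h

theorem q_le (x : X) : D.q x ≤ (1 + 4 * D.r) * p x := D.q_le_of_forall fun i => D.G_le i x

theorem base_le_q (x : X) : D.base x ≤ D.q x :=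
  (le_sqAdd_left _ _ x).trans (D.G_le_q none x)

theorem le_q (x : X) : p x ≤ (1 + 2 * D.r) * D.q x := by
  have hr := D.r_pos
  have h := D.base_le_q x
  rw [base_apply] at h
  have := (le_max_left _ _).trans h
  rwa [inv_mul_le_iff₀ (by positivity)] at this

theorem isEquivalentNorm_q (hp : IsEquivalentNorm p) : IsEquivalentNorm D.q := by
  obtain ⟨a, b, ha, hb, hab⟩ := hp
  have hr := D.r_pos
  refine ⟨a / (1 + 2 * D.r), (1 + 4 * D.r) * b, by positivity, by positivity, fun x => ⟨?_, ?_⟩⟩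
  · rw [div_mul_eq_mul_div, div_le_iff₀' (by positivity)]
    exact (hab x).1.trans (D.le_q x)
  · refine (D.q_le x).trans ?_
    rw [mul_assoc]
    gcongr
    exact (hab x).2

theorem weight_sq_mul_defect_le (i : Option ℕ) (x y : X) :
    D.weight i ^ 2 * defect N x y ≤ defect (D.G i) x y := by
  rcases i with _ | n
  · rw [G, defect_sqAdd, defect_scale, weight]
    linarith [defect_nonneg D.base x y]
  · rw [G, rest, defect_sqAdd, defect_sqAdd, defect_sqAdd, defect_scale _ N]
    linarith [defect_nonneg (D.absF n) x y, defect_nonneg (scale D.δ (N.comp (D.proj n))) x y,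
      defect_nonneg (scale D.δ D.T) x y]

/-- If the midpoint is almost of norm one, an index almost attaining the supremum there has defect
at most `1 - (1 - η) ^ 2`. The index may depend on the pair of points, so every use needs estimates
uniform in it. -/
theorem defect_G_le {i : Option ℕ} {x y : X} (hx : D.q x ≤ 1) (hy : D.q y ≤ 1) {η : ℝ}
    (hη : η ≤ 1) (h : 1 - η < D.G i ((2⁻¹ : ℝ) • (x + y))) : defect (D.G i) x y ≤ 2 * η := by
  have h1 : D.G i x ^ 2 ≤ 1 ^ 2 := by gcongr; exact (D.G_le_q i x).trans hx
  have h2 : D.G i y ^ 2 ≤ 1 ^ 2 := by gcongr; exact (D.G_le_q i y).trans hy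
  have h3 : (1 - η) ^ 2 ≤ D.G i ((2⁻¹ : ℝ) • (x + y)) ^ 2 := by
    have : 0 ≤ 1 - η := by linarith
    gcongr
  unfold defect
  nlinarith [sq_nonneg η]

end RenormingData

/-! ### Rotundity of the new norm -/

namespace RenormingData

variable {p N : Seminorm ℝ X} (D : RenormingData p N)

theorem defect_proj_le (n : ℕ) (x y : X) :
    D.δ ^ 2 * defect N (D.proj n x) (D.proj n y) ≤ defect (D.G (some n)) x y := by
  rw [G, rest, defect_sqAdd, defect_sqAdd, defect_sqAdd, defect_scale, defect_comp]
  linarith [defect_nonneg (D.absF n) x y, defect_nonneg (scale (D.weight (some n)) N) x y,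
    defect_nonneg (scale D.δ D.T) x y]

theorem norm_toL2_sub_le (n : ℕ) (x y : X) :
    D.δ ^ 2 * (‖D.toL2 (y - x)‖ ^ 2 / 4) ≤ defect (D.G (some n)) x y := by
  rw [G, rest, defect_sqAdd, defect_sqAdd, defect_sqAdd, defect_scale _ D.T, T, defect_inner]
  linarith [defect_nonneg (D.absF n) x y, defect_nonneg (scale (D.weight (some n)) N) x y,
    defect_nonneg (scale D.δ (N.comp (D.proj n))) x y]

theorem p_le_three {x : X} (hx : D.q x ≤ 1) : p x ≤ 3 := by
  have := D.le_q x
  nlinarith [D.r_pos, D.r_le_one]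

theorem isURED_q (hN : IsURED N) (hN0 : ∀ x, N x = 0 → x = 0) : IsURED D.q := by
  intro v hv x y c hx hy hxy hm
  have hv0 : v ≠ 0 := fun h => by simp [h] at hv
  have hδ := D.δ_pos
  have hM := one_pos.trans_le D.one_le_M
  have hC := D.C_pos
  suffices H : ∀ ε > 0, ∃ η > 0, ∀ (x y : X) (c : ℝ), D.q x ≤ 1 → D.q y ≤ 1 → y - x = c • v →
      1 - η < D.q ((2⁻¹ : ℝ) • (x + y)) → |c| < ε by
    rw [Metric.tendsto_nhds]
    intro ε hε
    obtain ⟨η, hη, h⟩ := H ε hε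
    filter_upwards [hm.eventually_const_lt (show 1 - η < 1 by linarith)] with n hn
    rw [Real.dist_0_eq_abs]
    exact h _ _ _ (hx n) (hy n) (hxy n) hn
  intro ε hε
  obtain ⟨δ₀, hδ₀, hD⟩ := hN.exists_defect hN0 hv0 hε (3 * D.C * D.M * 3)
  have hnone : ∀ {η : ℝ} {x y : X} {c : ℝ}, η ≤ 1 → η ≤ D.δ ^ 2 * δ₀ / 4 → D.q x ≤ 1 → D.q y ≤ 1 →
      y - x = c • v → 1 - η < D.G none ((2⁻¹ : ℝ) • (x + y)) → |c| < ε := by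
    intro η x y c hη1 hη hx hy hxy hi
    refine hD x y c ?_ hxy ?_
    · refine (D.N_le x).trans ?_
      have h1 := D.p_le_three hx
      have h2 : D.M * 3 ≤ 3 * D.C * D.M * 3 := by nlinarith [D.one_le_C]
      exact (mul_le_mul_of_nonneg_left h1 hM.le).trans h2
    · have h1 := (D.weight_sq_mul_defect_le none x y).trans (D.defect_G_le hx hy hη1 hi)
      have h2 : D.δ ^ 2 * defect N x y < D.δ ^ 2 * δ₀ := by
        have : 0 < D.δ ^ 2 * δ₀ := by positivity
        rw [weight] at h1
        linarith
      exact lt_of_mul_lt_mul_left h2 (by positivity)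
  -- The dichotomy that makes the estimate uniform in `n`: either all `φ (n + 1)` vanish at `v`, so
  -- that `proj n` fixes `v`, or the Hilbertian term sees `v` with a weight independent of `n`.
  by_cases hφ : D.toL2 v = 0
  · refine ⟨min 1 (D.δ ^ 2 * δ₀ / 4), by positivity, fun x y c hx hy hxy h => ?_⟩
    obtain ⟨i, hi⟩ := D.exists_lt_of_lt_q h
    rcases i with _ | n
    · exact hnone (min_le_left _ _) (min_le_right _ _) hx hy hxy hi
    · refine hD (D.proj n x) (D.proj n y) c ?_ ?_ ?_
      · refine (D.N_proj_le n x).trans ?_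
        gcongr
        exact D.p_le_three hx
      · have h0 : D.φ (n + 1) v = 0 := by
          have := D.toL2_apply v (n + 1)
          rw [hφ] at this
          simpa using this.symm
        rw [← map_sub, hxy, map_smul, proj_apply, h0, zero_smul, sub_zero]
      · have h1 := (D.defect_proj_le n x y).trans (D.defect_G_le hx hy (min_le_left _ _) hi)
        have h2 : D.δ ^ 2 * defect N (D.proj n x) (D.proj n y) < D.δ ^ 2 * δ₀ := by
          have : 0 < D.δ ^ 2 * δ₀ := by positivity
          have := min_le_right 1 (D.δ ^ 2 * δ₀ / 4)
          linarith
        exact lt_of_mul_lt_mul_left h2 (by positivity)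
  · have hS : 0 < ‖D.toL2 v‖ := norm_pos_iff.2 hφ
    refine ⟨min (min 1 (D.δ ^ 2 * δ₀ / 4)) (D.δ ^ 2 * (ε * ‖D.toL2 v‖) ^ 2 / 16), by positivity,
      fun x y c hx hy hxy h => ?_⟩
    have hη1 := (min_le_left (min 1 (D.δ ^ 2 * δ₀ / 4))
      (D.δ ^ 2 * (ε * ‖D.toL2 v‖) ^ 2 / 16)).trans (min_le_left _ _)
    obtain ⟨i, hi⟩ := D.exists_lt_of_lt_q h
    rcases i with _ | n
    · exact hnone hη1 ((min_le_left _ _).trans (min_le_right _ _)) hx hy hxy hi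
    · have h1 := (D.norm_toL2_sub_le n x y).trans (D.defect_G_le hx hy hη1 hi)
      have h2 : D.δ ^ 2 * (‖D.toL2 (y - x)‖ ^ 2) < D.δ ^ 2 * (ε * ‖D.toL2 v‖) ^ 2 := by
        have : 0 < D.δ ^ 2 * (ε * ‖D.toL2 v‖) ^ 2 := by positivity
        have := min_le_right (min 1 (D.δ ^ 2 * δ₀ / 4)) (D.δ ^ 2 * (ε * ‖D.toL2 v‖) ^ 2 / 16)
        linarith
      have h3 := lt_of_pow_lt_pow_left₀ 2 (by positivity)
        (lt_of_mul_lt_mul_left h2 (by positivity))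
      rw [hxy, map_smul, norm_smul, Real.norm_eq_abs] at h3
      exact lt_of_mul_lt_mul_right h3 hS.le

theorem weight_le {k : ℕ} {i : Option ℕ} (hi : ∀ n, i = some n → n < k) :
    D.δ / (k + 1) ≤ D.weight i := by
  have hδ := D.δ_pos
  rcases i with _ | n
  · exact div_le_self hδ.le (by linarith [k.cast_nonneg (α := ℝ)])
  · have : (n : ℝ) ≤ k := by exact_mod_cast (hi n rfl).le
    rw [weight]
    gcongr

/-- At each point of the unit sphere of the new norm, only finitely many of the cutting norms
matter. -/
theorem exists_lt_one_eventually {x : X} (hx : D.q x = 1) :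
    ∃ a < 1, ∃ k, ∀ n, k ≤ n → D.G (some n) x ≤ a := by
  have hμ := D.μ_pos
  have hμ1 : D.μ ≤ 1 := by linarith [D.μ_le, D.r_le_one]
  set Λ := limsupSeminorm D.absF D.absF_bdd x
  have hΛ0 : 0 ≤ Λ := apply_nonneg _ x
  have hΛ : (1 + D.μ) * Λ ≤ 1 := by
    have h := D.base_le_q x
    rw [base_apply, hx] at h
    exact (le_max_right _ _).trans h
  -- This holds because `(1 + μ) * (1 - μ / 3) > 1` for `0 < μ ≤ 1`. The loss of order `μ` outweighs
  -- the at most `9 * κ ^ 2 ≤ μ / 4` coming from `rest`.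
  have hlt : Λ < 1 - D.μ / 3 := by nlinarith
  obtain ⟨k, hk⟩ := eventually_atTop.1 (eventually_lt_of_limsupSeminorm_lt D.absF_bdd hlt)
  have hp := D.p_le_three hx.le
  refine ⟨√(1 - D.μ / 36), ?_, k, fun n hn => ?_⟩
  · rw [Real.sqrt_lt' one_pos]
    linarith
  · refine Real.le_sqrt_of_sq_le ?_
    rw [G_some_sq]
    have h1 : D.F n x ^ 2 ≤ (1 - D.μ / 3) ^ 2 := by
      rw [← sq_abs]
      gcongr
      exact (hk n hn).le
    have h2 : D.rest n x ^ 2 ≤ (D.κ * 3) ^ 2 := by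
      have := D.κ_pos
      gcongr
      exact (D.rest_le n x).trans (by gcongr)
    have h3 := D.κ_sq_le
    nlinarith

theorem isLUR_q (hp : IsEquivalentNorm p) (hNe : IsEquivalentNorm N) (hN : IsLUR N) :
    IsLUR D.q := by
  intro x hx y hy hm
  have hδ := D.δ_pos
  have key : Tendsto (fun n => N (x - y n)) atTop (𝓝 0) := by
    rw [Metric.tendsto_nhds]
    intro ε hε
    obtain ⟨δ₀, hδ₀, hD⟩ := hN.exists_defect x hε
    obtain ⟨a, ha, k, hk⟩ := D.exists_lt_one_eventually hx
    set τ := D.δ / ((k : ℝ) + 1)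
    have hτ : 0 < τ := by positivity
    set η := min (min 1 ((1 - a) / 2)) (τ ^ 2 * δ₀ / 4)
    have h1a : 0 < (1 - a) / 2 := by linarith
    have hη : 0 < η := by positivity
    have hη1 : η ≤ 1 := (min_le_left _ _).trans (min_le_left _ _)
    have hηa : η ≤ (1 - a) / 2 := (min_le_left _ _).trans (min_le_right _ _)
    have hητ : η ≤ τ ^ 2 * δ₀ / 4 := min_le_right _ _
    filter_upwards [hm.eventually_const_lt (show 1 - η < 1 by linarith)] with j hj
    rw [Real.dist_0_eq_abs, abs_of_nonneg (apply_nonneg _ _)]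
    obtain ⟨i, hi⟩ := D.exists_lt_of_lt_q hj
    -- For `n ≥ k` the midpoint value is at most `(a + 1) / 2`, too small for `G (some n)` to nearly
    -- attain the supremum. Hence the weight of `N` is at least `τ`.
    have hik : ∀ n, i = some n → n < k := by
      rintro n rfl
      by_contra! hn
      have h1 := map_midpoint_le (D.G (some n)) x (y j)
      have h2 := hk n hn
      have h3 := (D.G_le_q (some n) (y j)).trans (hy j)
      linarith
    apply hD
    have h1 := (D.weight_sq_mul_defect_le i x (y j)).trans (D.defect_G_le hx.le (hy j) hη1 hi)
    have h2 : τ ^ 2 * defect N x (y j) ≤ D.weight i ^ 2 * defect N x (y j) := by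
      have := defect_nonneg N x (y j)
      have := D.weight_le hik
      gcongr
    have h3 : 0 < τ ^ 2 * δ₀ := by positivity
    exact lt_of_mul_lt_mul_left (show τ ^ 2 * defect N x (y j) < τ ^ 2 * δ₀ by linarith)
      (by positivity)
  obtain ⟨_, b, _, hb, hab⟩ := D.isEquivalentNorm_q hp
  obtain ⟨a', _, ha', _, hab'⟩ := hNe
  refine squeeze_zero (fun n => apply_nonneg _ _) (fun n => ?_)
    (by simpa using key.const_mul (b / a'))
  refine (hab _).2.trans ?_
  rw [div_mul_eq_mul_div, le_div_iff₀ ha', mul_assoc, mul_comm ‖x - y n‖]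
  gcongr
  exact (hab' _).1

/-! ### Flat segments at the peaks and failure of WUR -/

/-- The peaks of the functionals `F n`. -/
def pt (n : ℕ) : X := D.b + D.r • D.w n

/-- Points on the segment through the peak `pt n` in direction `v n`. -/
noncomputable def seg (n : ℕ) (t : ℝ) : X := D.pt n + (t * (D.r / 4)) • D.v n

theorem seg_zero (n : ℕ) : D.seg n 0 = D.pt n := by simp [seg]

theorem p_seg_le (n : ℕ) {t : ℝ} (ht : |t| ≤ 1) : p (D.seg n t) ≤ 1 + 2 * D.r := by
  have hr := D.r_pos
  have h1 := map_add_le_add p (D.pt n) ((t * (D.r / 4)) • D.v n)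
  have h2 := map_add_le_add p D.b (D.r • D.w n)
  have h3 := D.p_b
  have h4 := D.p_w n
  have h5 := D.p_v_le n
  have h6 : |t| * (D.r / 4) ≤ 1 * (D.r / 4) := by gcongr
  rw [map_smul_eq_mul, norm_mul, Real.norm_eq_abs, Real.norm_of_nonneg (by positivity)] at h1
  rw [map_smul_eq_mul, Real.norm_of_nonneg hr.le] at h2
  have h7 : |t| * (D.r / 4) * p (D.v n) ≤ 1 * (D.r / 4) * 2 := by gcongr
  have h8 : D.r * p (D.w n) ≤ D.r * 1 := by gcongr
  unfold seg pt at *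
  linarith

theorem F_seg_self (n : ℕ) (t : ℝ) : D.F n (D.seg n t) = 1 + 2 * D.μ := by
  have := D.φ_v_of_ne (m := n) (n := n) (by omega)
  simp only [F_apply, seg, pt, map_add, map_smul, D.B_b, D.B_w, D.B_v, D.φ_b, D.φ_self, this,
    smul_eq_mul, μ]
  ring

/-- Among the functionals `B` and `φ m`, only `φ (n + 1)` varies along `v n`. The length factor `r /
4` of the segment keeps that variation of `F (n + 1)` within `μ / 2`, well below the peak. -/
theorem F_seg_of_ne {m n : ℕ} (h : m ≠ n) (t : ℝ) :
    D.F m (D.seg n t) = 1 + if m = n + 1 then t * (D.μ / 2) else 0 := by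
  split_ifs with h'
  · subst h'
    simp only [F_apply, seg, pt, map_add, map_smul, D.B_b, D.B_w, D.B_v, D.φ_b, D.φ_ne h,
      D.φ_v_self, smul_eq_mul, μ]
    ring
  · simp only [F_apply, seg, pt, map_add, map_smul, D.B_b, D.B_w, D.B_v, D.φ_b, D.φ_ne h,
      D.φ_v_of_ne h', smul_eq_mul]
    ring

theorem base_seg_le (n : ℕ) {t : ℝ} (ht : |t| ≤ 1) : D.base (D.seg n t) ≤ 1 + D.μ := by
  have hμ := D.μ_pos
  have hr := D.r_pos
  rw [base_apply]
  refine max_le ?_ ?_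
  · have : (1 + 2 * D.r)⁻¹ * p (D.seg n t) ≤ 1 := by
      rw [inv_mul_le_one₀ (by positivity)]
      exact D.p_seg_le n ht
    linarith
  · refine mul_le_of_le_one_right (by positivity) (limsupSeminorm_le _ ?_)
    filter_upwards [eventually_gt_atTop (n + 1)] with m hm
    rw [absF_apply, D.F_seg_of_ne (by omega), if_neg (by omega)]
    simp

theorem norm_toL2_seg_le (n : ℕ) {t : ℝ} (ht : |t| ≤ 1) :
    ‖D.toL2 (D.seg n t)‖ ≤ 2 * (1 / 2) ^ n := by
  have hr := D.r_pos
  have hr1 := D.r_le_one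
  have h1 := D.norm_toL2_w_le n
  have h2 := D.norm_toL2_w_le (n + 1)
  have e : D.toL2 (D.seg n t) =
      D.r • D.toL2 (D.w n) + (t * (D.r / 4)) • D.toL2 (D.w (n + 1)) := by
    simp [seg, pt, BiorthogonalSystem.v, D.toL2_b, D.toL2_e]
  rw [e]
  refine (norm_add_le _ _).trans ?_
  rw [norm_smul, norm_smul, norm_mul, Real.norm_eq_abs t, Real.norm_of_nonneg hr.le,
    Real.norm_of_nonneg (show 0 ≤ D.r / 4 by positivity)]
  have h3 : D.r * ‖D.toL2 (D.w n)‖ ≤ 1 * (1 / 2) ^ n := by gcongr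
  have h4 : |t| * (D.r / 4) * ‖D.toL2 (D.w (n + 1))‖ ≤ 1 * 1 * (1 / 2) ^ (n + 1) := by
    gcongr
    linarith
  have h5 : (0 : ℝ) < (1 / 2) ^ n := by positivity
  rw [pow_succ] at h4
  linarith

/-- The error in the flatness of the unit sphere near the `n`-th peak. -/
noncomputable def err (n : ℕ) : ℝ :=
  D.δ ^ 2 * (2 * (1 / 2) ^ n) ^ 2 + D.δ ^ 2 * (3 * D.M / (n + 1)) ^ 2

theorem err_nonneg (n : ℕ) : 0 ≤ D.err n := by
  unfold err
  positivity

theorem tendsto_err : Tendsto D.err atTop (𝓝 0) := by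
  have h1 : Tendsto (fun n : ℕ => (1 / 2 : ℝ) ^ n) atTop (𝓝 0) :=
    tendsto_pow_atTop_nhds_zero_of_lt_one (by norm_num) (by norm_num)
  have h2 : Tendsto (fun n : ℕ => 3 * D.M / ((n : ℝ) + 1)) atTop (𝓝 0) := by
    have := (tendsto_one_div_add_atTop_nhds_zero_nat (𝕜 := ℝ)).const_mul (3 * D.M)
    simpa [div_eq_mul_inv] using this
  have := (((h1.const_mul 2).pow 2).const_mul (D.δ ^ 2)).add ((h2.pow 2).const_mul (D.δ ^ 2))
  rw [show D.δ ^ 2 * (2 * (0 : ℝ)) ^ 2 + D.δ ^ 2 * (0 : ℝ) ^ 2 = 0 by ring] at this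
  exact this

theorem q_pt_ge (n : ℕ) : 1 + 2 * D.μ ≤ D.q (D.pt n) := by
  have h := (le_sqAdd_left (D.absF n) (D.rest n) (D.pt n)).trans (D.G_le_q (some n) (D.pt n))
  rw [absF_apply, ← seg_zero, F_seg_self] at h
  rw [← seg_zero]
  exact (le_abs_self _).trans h

/-- Every index other than `some n` stays below the peak value `1 + 2 * μ`. For `some n` itself,
moving along the segment changes only the Hilbertian term and the weighted `N`, both of which `err
n` bounds. -/
theorem q_seg_sq_le (n : ℕ) {t : ℝ} (ht : |t| ≤ 1) :
    D.q (D.seg n t) ≤ √(D.q (D.pt n) ^ 2 + D.err n) := by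
  have hμ := D.μ_pos
  have hκ := D.κ_pos
  have hκμ := D.κ_sq_le
  have herr := D.err_nonneg n
  have hM := one_pos.trans_le D.one_le_M
  have hp3 : p (D.seg n t) ≤ 3 := by linarith [D.p_seg_le n ht, D.r_le_one]
  have hq : (1 + 2 * D.μ) ^ 2 ≤ D.q (D.pt n) ^ 2 := by
    have := D.q_pt_ge n
    gcongr
  refine D.q_le_of_forall fun i => Real.le_sqrt_of_sq_le ?_
  rcases i with _ | m
  · rw [G_none_sq]
    have h1 : D.base (D.seg n t) ^ 2 ≤ (1 + D.μ) ^ 2 := by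
      gcongr
      exact D.base_seg_le n ht
    have h2 : (D.δ * N (D.seg n t)) ^ 2 ≤ (D.κ * 3) ^ 2 := by
      have := D.δ_pos
      exact pow_le_pow_left₀ (by positivity) ((D.δ_N_le _).trans (by gcongr)) 2
    nlinarith
  · rw [G_some_sq]
    by_cases h : m = n
    · subst h
      have h1 := pow_le_pow_left₀ (apply_nonneg _ _) (D.G_le_q (some m) (D.pt m)) 2
      rw [G_some_sq, ← seg_zero, F_seg_self, rest_sq] at h1
      rw [seg_zero] at h1
      have h2 : D.proj m (D.seg m t) = D.proj m (D.pt m) := by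
        rw [seg, map_add, map_smul, proj_v, smul_zero, add_zero]
      have h3 := D.norm_toL2_seg_le m ht
      have h4 : ‖D.toL2 (D.seg m t)‖ ^ 2 ≤ (2 * (1 / 2) ^ m) ^ 2 := by gcongr
      have h5 : (N (D.seg m t) / (m + 1)) ^ 2 ≤ (3 * D.M / (m + 1)) ^ 2 := by
        gcongr
        calc N (D.seg m t) ≤ D.M * p (D.seg m t) := D.N_le _
          _ ≤ D.M * 3 := by gcongr
          _ = _ := mul_comm _ _
      have h6 := mul_le_mul_of_nonneg_left h4 (sq_nonneg D.δ)
      have h7 := mul_le_mul_of_nonneg_left h5 (sq_nonneg D.δ)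
      have h8 : 0 ≤ D.δ ^ 2 * ‖D.toL2 (D.pt m)‖ ^ 2 := by positivity
      have h9 : 0 ≤ D.δ ^ 2 * (N (D.pt m) / (m + 1)) ^ 2 := by positivity
      rw [F_seg_self, rest_sq, h2]
      unfold err
      linarith
    · have h1 : |D.F m (D.seg n t)| ≤ 1 + D.μ / 2 := by
        rw [D.F_seg_of_ne h]
        split_ifs
        · refine (abs_add_le _ _).trans ?_
          rw [abs_one, abs_mul, abs_of_pos (show 0 < D.μ / 2 by positivity)]
          nlinarith
        · rw [add_zero, abs_one]
          linarith
      have h2 : D.F m (D.seg n t) ^ 2 ≤ (1 + D.μ / 2) ^ 2 := by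
        rw [← sq_abs]
        gcongr
      have h3 : D.rest m (D.seg n t) ^ 2 ≤ (D.κ * 3) ^ 2 := by
        gcongr
        exact (D.rest_le m _).trans (by gcongr)
      nlinarith

theorem not_isWUR_q : ¬ IsWUR D.q := by
  intro hW
  have hμ := D.μ_pos
  have hr := D.r_pos
  have hq1 : ∀ n, 1 ≤ D.q (D.pt n) := fun n => by linarith [D.q_pt_ge n]
  -- Scaling by `(s n)⁻¹` puts the endpoints of the `n`-th segment in the unit ball; their midpoint
  -- is the scaled peak, whose norm tends to `1` with `err n → 0`.
  set s : ℕ → ℝ := fun n => √(D.q (D.pt n) ^ 2 + D.err n)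
  have hs_sq : ∀ n, s n ^ 2 = D.q (D.pt n) ^ 2 + D.err n := fun n =>
    Real.sq_sqrt (by have := D.err_nonneg n; positivity)
  have hqs : ∀ n, D.q (D.pt n) ≤ s n := fun n =>
    Real.le_sqrt_of_sq_le (by linarith [D.err_nonneg n])
  have hs : ∀ n, 0 < s n := fun n => by linarith [hq1 n, hqs n]
  have hball : ∀ n (t : ℝ), |t| ≤ 1 → D.q ((s n)⁻¹ • D.seg n t) ≤ 1 := fun n t ht => by
    rw [map_smul_eq_mul, norm_inv, Real.norm_of_nonneg (hs n).le, inv_mul_le_one₀ (hs n)]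
    exact D.q_seg_sq_le n ht
  have hmid : ∀ n, D.q ((2⁻¹ : ℝ) • ((s n)⁻¹ • D.seg n (-1) + (s n)⁻¹ • D.seg n 1)) =
      D.q (D.pt n) / s n := fun n => by
    rw [show (2⁻¹ : ℝ) • ((s n)⁻¹ • D.seg n (-1) + (s n)⁻¹ • D.seg n 1) = (s n)⁻¹ • D.pt n by
      unfold seg; module, map_smul_eq_mul, norm_inv, Real.norm_of_nonneg (hs n).le]
    field_simp
  have hlim : Tendsto (fun n => D.q (D.pt n) / s n) atTop (𝓝 1) := by
    refine tendsto_of_tendsto_of_tendsto_of_le_of_le (g := fun n => 1 - D.err n)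
      (by simpa using D.tendsto_err.const_sub 1) tendsto_const_nhds (fun n => ?_)
      (fun n => (div_le_one (hs n)).2 (hqs n))
    change 1 - D.err n ≤ D.q (D.pt n) / s n
    rw [le_div_iff₀ (hs n)]
    have h1 := hs_sq n
    have h2 := hqs n
    have h3 := hq1 n
    have h4 := D.err_nonneg n
    have h5 : s n - D.q (D.pt n) ≤ D.err n := by nlinarith
    nlinarith [hs n]
  have hw := hW (fun n => (s n)⁻¹ • D.seg n (-1)) (fun n => (s n)⁻¹ • D.seg n 1)
    (fun n => hball n _ (by norm_num)) (fun n => hball n _ (by norm_num))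
    (by simpa only [hmid] using hlim)
  -- The functional `f` takes the value `1` on each `v n`, so it detects the differences, whose
  -- lengths stay bounded below because `s n` is bounded.
  have hf : Tendsto (fun n => D.f ((s n)⁻¹ • D.seg n 1 - (s n)⁻¹ • D.seg n (-1))) atTop (𝓝 0) := by
    have hc := WeakBilin.eval_continuous (topDualPairing ℝ X).flip D.f
    rw [← map_zero D.f]
    exact (hc.tendsto 0).comp hw
  have hfe : ∀ n, D.f ((s n)⁻¹ • D.seg n 1 - (s n)⁻¹ • D.seg n (-1)) = (s n)⁻¹ * (D.r / 2) :=
    fun n => by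
      rw [show (s n)⁻¹ • D.seg n 1 - (s n)⁻¹ • D.seg n (-1) = ((s n)⁻¹ * (D.r / 2)) • D.v n by
        unfold seg; module, map_smul, D.f_v, smul_eq_mul, mul_one]
  simp only [hfe] at hf
  have hle : D.r / 2 * 1 ≤ 15 * 0 := by
    refine le_of_tendsto_of_tendsto' (hlim.const_mul (D.r / 2)) (hf.const_mul 15) fun n => ?_
    have h1 : D.q (D.pt n) ≤ 15 := by
      have h2 := D.q_le (D.pt n)
      have h3 := D.p_seg_le n (t := 0) (by norm_num)
      rw [seg_zero] at h3
      nlinarith [D.r_le_one, apply_nonneg p (D.pt n)]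
    have := hs n
    calc D.r / 2 * (D.q (D.pt n) / s n) ≤ D.r / 2 * (15 / s n) := by gcongr
      _ = _ := by ring
  linarith

end RenormingData

/-! ### Density, and combining URED with LUR -/

theorem IsEquivalentNorm.exists_le_mul {p N : Seminorm ℝ X} (hp : IsEquivalentNorm p)
    (hN : IsEquivalentNorm N) : ∃ M, 1 ≤ M ∧ ∀ x, N x ≤ M * p x := by
  obtain ⟨a, _, ha, _, hab⟩ := hp
  obtain ⟨_, b, _, hb, hab'⟩ := hN
  refine ⟨max 1 (b / a), le_max_left _ _, fun x => ?_⟩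
  calc N x ≤ b * ‖x‖ := (hab' x).2
    _ ≤ b * (p x / a) := by
        gcongr
        rw [le_div_iff₀' ha]
        exact (hab x).1
    _ = b / a * p x := by ring
    _ ≤ _ := by gcongr; exact le_max_right _ _

theorem exists_renormingData (hdim : ¬ FiniteDimensional ℝ X) {p N : Seminorm ℝ X}
    (hp : IsEquivalentNorm p) (hN : IsEquivalentNorm N) {r : ℝ} (hr : 0 < r) (hr1 : r ≤ 1) :
    ∃ D : RenormingData p N, D.r = r := by
  obtain ⟨s⟩ := exists_biorthogonalSystem hdim hp
  obtain ⟨M, hM1, hM⟩ := hp.exists_le_mul hN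
  have hM0 := one_pos.trans_le hM1
  have hC0 := one_pos.trans_le s.one_le_C
  have hμ : r / s.C * r / 2 ≤ r := by
    have : r / s.C ≤ 1 := (div_le_one hC0).2 (hr1.trans s.one_le_C)
    nlinarith
  have hμ0 : 0 < r / s.C * r / 2 := by positivity
  have e : r / s.C * r / 2 / 36 / (4 * s.C * M) * (4 * s.C * M) = r / s.C * r / 2 / 36 := by
    field_simp
  exact ⟨{ s with
    M := M, r := r, δ := r / s.C * r / 2 / 36 / (4 * s.C * M)
    one_le_M := hM1, N_le := hM, r_pos := hr, r_le_one := hr1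
    δ_pos := by positivity
    δ_le := by rw [e]; linarith
    δ_sq_le := by rw [e]; nlinarith }, rfl⟩

theorem isEquivalentNorm_scale {p : Seminorm ℝ X} (hp : IsEquivalentNorm p) {t : ℝ} (ht : 0 < t) :
    IsEquivalentNorm (scale t p) := by
  obtain ⟨a, b, ha, hb, hab⟩ := hp
  refine ⟨t * a, t * b, by positivity, by positivity, fun x => ?_⟩
  rw [scale_apply, abs_of_pos ht, mul_assoc, mul_assoc]
  exact ⟨by gcongr; exact (hab x).1, by gcongr; exact (hab x).2⟩

theorem isDenseClass_of_isURED (hdim : ¬ FiniteDimensional ℝ X) {N : Seminorm ℝ X}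
    (hNe : IsEquivalentNorm N) (hN : IsURED N) :
    IsDenseClass {q : Seminorm ℝ X | IsEquivalentNorm q ∧ IsURED q ∧ ¬ IsWUR q ∧
      (IsLUR N → IsLUR q)} := by
  intro p hp ε hε
  -- After `p` is shrunk by `1 + 4 * r`, the total distortion is `(1 + 4 * r) * (1 + 2 * r) ≤ 1 + 14
  -- * r` for `r ≤ 1`.
  set r := min 1 (ε / 14)
  have hr : 0 < r := by positivity
  have hr1 : r ≤ 1 := min_le_left _ _
  have hrε : r ≤ ε / 14 := min_le_right _ _
  have ht : 0 < (1 + 4 * r)⁻¹ := by positivity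
  have hp' := isEquivalentNorm_scale hp ht
  obtain ⟨D, hD⟩ := exists_renormingData hdim hp' hNe hr hr1
  refine ⟨D.q, ⟨D.isEquivalentNorm_q hp', D.isURED_q hN fun x => hNe.eq_zero, D.not_isWUR_q,
    D.isLUR_q hp' hNe⟩, fun x => ⟨?_, ?_⟩⟩
  · have := D.q_le x
    rwa [hD, scale_apply, abs_of_pos ht, mul_inv_cancel_left₀ (by positivity)] at this
  · have h := D.le_q x
    rw [hD, scale_apply, abs_of_pos ht, inv_mul_le_iff₀ (by positivity), ← mul_assoc] at h
    refine h.trans ?_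
    gcongr
    nlinarith

theorem isEquivalentNorm_sqAdd {a b : Seminorm ℝ X} (ha : IsEquivalentNorm a)
    (hb : IsEquivalentNorm b) : IsEquivalentNorm (sqAdd a b) := by
  obtain ⟨a₁, b₁, ha₁, hb₁, h₁⟩ := ha
  obtain ⟨a₂, b₂, ha₂, hb₂, h₂⟩ := hb
  refine ⟨a₁, b₁ + b₂, ha₁, by positivity, fun x => ⟨(h₁ x).1.trans (le_sqAdd_left _ _ x), ?_⟩⟩
  rw [add_mul]
  exact (sqAdd_le _ _ x).trans (add_le_add (h₁ x).2 (h₂ x).2)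

theorem tendsto_defect_zero {N : Seminorm ℝ X} {x y : ℕ → X} (hx : ∀ n, N (x n) ≤ 1)
    (hy : ∀ n, N (y n) ≤ 1)
    (hm : Tendsto (fun n => N ((2⁻¹ : ℝ) • (x n + y n))) atTop (𝓝 1)) :
    Tendsto (fun n => defect N (x n) (y n)) atTop (𝓝 0) := by
  have hm' := (hm.pow 2).const_sub 1
  rw [one_pow, sub_self] at hm'
  refine squeeze_zero (fun n => defect_nonneg _ _ _) (fun n => ?_) hm'
  have h1 := pow_le_one₀ (n := 2) (apply_nonneg N _) (hx n)
  have h2 := pow_le_one₀ (n := 2) (apply_nonneg N _) (hy n)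
  unfold defect
  linarith

/-- Defects add and are nonnegative, so a small defect of the sum forces a small defect of `a`. -/
theorem IsURED.sqAdd {a b : Seminorm ℝ X} (ha : IsURED a) (ha0 : ∀ x, a x = 0 → x = 0) :
    IsURED (sqAdd a b) := by
  intro v hv x y c hx hy hxy hm
  have hv0 : v ≠ 0 := fun h => by simp [h] at hv
  have hD := tendsto_defect_zero hx hy hm
  rw [Metric.tendsto_nhds]
  intro ε hε
  obtain ⟨δ, hδ, h⟩ := ha.exists_defect ha0 hv0 hε 1
  filter_upwards [hD.eventually_lt_const hδ] with n hn
  rw [Real.dist_0_eq_abs]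
  rw [defect_sqAdd] at hn
  exact h _ _ _ ((le_sqAdd_left a b _).trans (hx n)) (hxy n)
    (by linarith [defect_nonneg b (x n) (y n)])

theorem IsLUR.sqAdd {a b : Seminorm ℝ X} (hb : IsLUR b) (ha' : IsEquivalentNorm a)
    (hb' : IsEquivalentNorm b) : IsLUR (sqAdd a b) := by
  intro x hx y hy hm
  have hD := tendsto_defect_zero (fun _ => hx.le) hy hm
  have key : Tendsto (fun n => b (x - y n)) atTop (𝓝 0) := by
    rw [Metric.tendsto_nhds]
    intro ε hε
    obtain ⟨δ, hδ, h⟩ := hb.exists_defect x hε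
    filter_upwards [hD.eventually_lt_const hδ] with n hn
    rw [Real.dist_0_eq_abs, abs_of_nonneg (apply_nonneg _ _)]
    rw [defect_sqAdd] at hn
    exact h _ (by linarith [defect_nonneg a x (y n)])
  obtain ⟨M, -, hM⟩ := hb'.exists_le_mul (isEquivalentNorm_sqAdd ha' hb')
  exact squeeze_zero (fun n => apply_nonneg _ _) (fun n => hM _)
    (by simpa using key.const_mul M)

theorem IsDenseClass.mono {S T : Set (Seminorm ℝ X)} (hS : IsDenseClass S) (h : S ⊆ T) :
    IsDenseClass T := fun p hp ε hε =>
  let ⟨q, hq, hpq⟩ := hS p hp ε hε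
  ⟨q, h hq, hpq⟩

theorem IsDenseClass.nonempty {S : Set (Seminorm ℝ X)} (hS : IsDenseClass S) {p : Seminorm ℝ X}
    (hp : IsEquivalentNorm p) : S.Nonempty :=
  let ⟨q, hq, _⟩ := hS p hp 1 one_pos
  ⟨q, hq⟩

end Renorming

theorem theoremB {X : Type*} [NormedAddCommGroup X] [NormedSpace ℝ X] [CompleteSpace X]
    (hdim : ¬ FiniteDimensional ℝ X)
    (hURED : ∃ p : Seminorm ℝ X, Renorming.IsEquivalentNorm p ∧ Renorming.IsURED p) :
    ((∃ p : Seminorm ℝ X, Renorming.IsEquivalentNorm p ∧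
        Renorming.IsURED p ∧ ¬ Renorming.IsWUR p) ∧
      Renorming.IsDenseClass {p : Seminorm ℝ X | Renorming.IsEquivalentNorm p ∧
        Renorming.IsURED p ∧ ¬ Renorming.IsWUR p}) ∧
    ((∃ p : Seminorm ℝ X, Renorming.IsEquivalentNorm p ∧ Renorming.IsLUR p) →
      (∃ p : Seminorm ℝ X, Renorming.IsEquivalentNorm p ∧
        Renorming.IsURED p ∧ ¬ Renorming.IsWUR p ∧ Renorming.IsLUR p) ∧
      Renorming.IsDenseClass {p : Seminorm ℝ X | Renorming.IsEquivalentNorm p ∧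
        Renorming.IsURED p ∧ ¬ Renorming.IsWUR p ∧ Renorming.IsLUR p}) := by
  obtain ⟨u, hue, hu⟩ := hURED
  have h := Renorming.isDenseClass_of_isURED hdim hue hu
  have h' := h.mono (T := {p : Seminorm ℝ X | Renorming.IsEquivalentNorm p ∧
      Renorming.IsURED p ∧ ¬ Renorming.IsWUR p}) fun q hq => ⟨hq.1, hq.2.1, hq.2.2.1⟩
  refine ⟨⟨h'.nonempty hue, h'⟩, ?_⟩
  rintro ⟨l, hle, hl⟩
  have hN := Renorming.isDenseClass_of_isURED hdim (Renorming.isEquivalentNorm_sqAdd hue hle)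
    (hu.sqAdd fun x => hue.eq_zero)
  have hN' := hN.mono (T := {p : Seminorm ℝ X | Renorming.IsEquivalentNorm p ∧
      Renorming.IsURED p ∧ ¬ Renorming.IsWUR p ∧ Renorming.IsLUR p}) fun q hq =>
    ⟨hq.1, hq.2.1, hq.2.2.1, hq.2.2.2 (hl.sqAdd hue hle)⟩
  exact ⟨hN'.nonempty hue, hN'⟩
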